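/- Let $d,S\ge 0$ be integers and $\mathcal X\subseteq\mathbb R^d$. Let $\mathcal H$ be the class of functions $h:\mathcal X\to\mathbb R$ represented by binary regression trees with at most $S+1$ terminal nodes (that is, at most $S$ splits), where each non-terminal node splits according to $x_i\le q$ or $x_i>q$ for some $i\in\{1,\dots,d\}$ and $q\in\mathbb R$, and each terminal node carries an arbitrary constant $c\in\mathbb R$. For a class $\mathcal G$ of functions on $\mathcal X$ put $\mathcal G_+=\{g+c:g\in\mathcal G,\ c\in\mathbb R\}$, and let $\mathrm{vc}(\mathcal G)$ be the VC dimension of the class of subgraphs $\{(x,z)\in\mathcal X\times\mathbb R: z<g(x)\}$, $g\in\mathcal G$; $\mathcal G$ is called VC-subgraph if $\mathrm{vc}(\mathcal G)<\infty$. There are universal constants $C,C'>0$ (independent of $d$, $S$, $\mathcal X$ and of everything below) such that the following holds. (1) $\mathcal H=\mathcal H_+$, and $\mathcal H$ is VC-subgraph. If $S\ge 2$ and $d\ge 2$, then $$\mathrm{vc}(\mathcal H)=\mathrm{vc}(\mathcal H_+)\le C\,S^2(\log S)^2\log d .$$ (2) Let $0\le M<\infty$ and let $\mathcal H^M$ be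 the class of all $h\in\mathcal H$ with $\max_{x}h(x)-\min_{x}h(x)\le M$. Then $\mathcal H^M=(\mathcal H^M)_+$. Moreover, for every subclass $\mathcal G\subseteq\mathcal H^M$ (in particular $\mathcal G=\mathcal H^M$), $\mathcal G_+$ is VC-subgraph with $\mathrm{vc}(\mathcal G_+)\le\mathrm{vc}(\mathcal H)$, and for every probability measure $\pi_X$ on $\mathcal X$ the envelope $H(x):=\sup_{h\in\mathcal G}|h(x)-\mathbb E_{\pi_X}[h(X)]|$ is finite at every $x$ and satisfies $\|H\|_{\psi_2}\le C'M$, where $\|\xi\|_{\psi_2}=\inf\{c>0:\mathbb E_{\pi_X}[\exp(\xi(X)^2/c^2)]\le 2\}$ (with outer expectation if $\xi$ is not measurable). -/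

import Mathlib

open MeasureTheory
open scoped ENNReal

/-- A binary regression tree on `ℝ^d`. A terminal node carries a real value; a non-terminal node
carries a coordinate `i` and a threshold `q`, and splits according to `x i ≤ q` (left subtree)
or `x i > q` (right subtree). -/
inductive RegTree (d : ℕ) : Type
  | leaf (c : ℝ) : RegTree d
  | node (i : Fin d) (q : ℝ) (l r : RegTree d) : RegTree d

namespace RegTree

/-- The number of splits, that is, of non-terminal nodes. -/
def numSplits {d : ℕ} : RegTree d → ℕ
  | leaf _ => 0
  | node _ _ l r => l.numSplits + r.numSplits + 1

/-- The number of terminal nodes. -/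
def numLeaves {d : ℕ} : RegTree d → ℕ
  | leaf _ => 1
  | node _ _ l r => l.numLeaves + r.numLeaves

theorem numLeaves_eq {d : ℕ} (t : RegTree d) : t.numLeaves = t.numSplits + 1 := by
  induction t with
  | leaf c => rfl
  | node i q l r hl hr => simp only [numLeaves, numSplits, hl, hr]; omega

/-- The piecewise constant function on `ℝ^d` that a regression tree represents. -/
noncomputable def eval {d : ℕ} : RegTree d → (Fin d → ℝ) → ℝ
  | leaf c, _ => c
  | node i q l r, x => if x i ≤ q then l.eval x else r.eval x

theorem measurable_eval {d : ℕ} (t : RegTree d) : Measurable t.eval := by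
  induction t with
  | leaf c => exact measurable_const
  | node i q l r hl hr =>
    exact Measurable.ite (measurableSet_le (measurable_pi_apply i) measurable_const) hl hr

theorem exists_abs_eval_le {d : ℕ} (t : RegTree d) : ∃ B : ℝ, ∀ x, |t.eval x| ≤ B := by
  induction t with
  | leaf c => exact ⟨|c|, fun _ => le_rfl⟩
  | node i q l r hl hr =>
    obtain ⟨a, ha⟩ := hl
    obtain ⟨b, hb⟩ := hr
    refine ⟨max a b, fun x => ?_⟩
    simp only [eval]
    split_ifs
    · exact (ha x).trans (le_max_left a b)
    · exact (hb x).trans (le_max_right a b)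

end RegTree

/-- The class `ℋ` of regression trees with at most `S` splits, as functions on `𝒳 ⊆ ℝ^d`. -/
def regressionTrees (d S : ℕ) (𝒳 : Set (Fin d → ℝ)) : Set (𝒳 → ℝ) :=
  {h | ∃ t : RegTree d, t.numSplits ≤ S ∧ h = fun x : 𝒳 => t.eval (x : Fin d → ℝ)}

/-- Regression trees are integrable, so that the mean of a tree below is a genuine expectation. -/
theorem integrable_of_mem_regressionTrees {d S : ℕ} {𝒳 : Set (Fin d → ℝ)} {h : 𝒳 → ℝ}
    (hh : h ∈ regressionTrees d S 𝒳) (π : Measure 𝒳) [IsProbabilityMeasure π] :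
    Integrable h π := by
  obtain ⟨t, -, rfl⟩ := hh
  obtain ⟨B, hB⟩ := t.exists_abs_eval_le
  exact Integrable.of_bound
    (t.measurable_eval.comp measurable_subtype_coe).aestronglyMeasurable B
    (Filter.Eventually.of_forall fun x => hB x)

/-- The class of regression trees with at most `S` splits on `𝒳` whose range is bounded by `M`:
`max h - min h ≤ M` on `𝒳`. -/
def boundedRegressionTrees (d S : ℕ) (𝒳 : Set (Fin d → ℝ)) (M : ℝ) : Set (𝒳 → ℝ) :=
  {h | h ∈ regressionTrees d S 𝒳 ∧ ∀ x y : 𝒳, h x - h y ≤ M}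

/-- The augmentation `𝒢₊ = {g + c : g ∈ 𝒢, c ∈ ℝ}` of a class of functions. -/
def augmentation {X : Type*} (𝒢 : Set (X → ℝ)) : Set (X → ℝ) :=
  {f | ∃ g ∈ 𝒢, ∃ c : ℝ, f = fun x => g x + c}

/-- A finite set of points is shattered by a class of sets if the class cuts out all its
subsets. -/
def ShatteredBy {α : Type*} (F : Finset α) (𝒮 : Set (Set α)) : Prop :=
  ∀ T : Finset α, T ⊆ F → ∃ A ∈ 𝒮, (F : Set α) ∩ A = T

/-- The VC dimension of a class of sets: the supremum in `ℕ∞` of the sizes of shattered sets. -/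
noncomputable def setVCDim {α : Type*} (𝒮 : Set (Set α)) : ℕ∞ :=
  ⨆ (F : Finset α) (_ : ShatteredBy F 𝒮), (F.card : ℕ∞)

/-- The class of subgraphs `{(x, z) : z < g x}` of the functions in a class. -/
def subgraphs {X : Type*} (𝒢 : Set (X → ℝ)) : Set (Set (X × ℝ)) :=
  {A | ∃ g ∈ 𝒢, A = {p : X × ℝ | p.2 < g p.1}}

/-- The VC dimension of a class of functions: that of its class of subgraphs. -/
noncomputable def funVCDim {X : Type*} (𝒢 : Set (X → ℝ)) : ℕ∞ :=
  setVCDim (subgraphs 𝒢)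

/-- A class of functions is VC-subgraph if its VC dimension is finite. -/
def IsVCSubgraph {X : Type*} (𝒢 : Set (X → ℝ)) : Prop :=
  funVCDim 𝒢 < ⊤

/-- The deviations `|h(x) - E_π[h]|`, `h ∈ 𝒢`, whose supremum is the envelope at `x`. -/
def deviations {X : Type*} [MeasurableSpace X] (π : Measure X) (𝒢 : Set (X → ℝ)) (x : X) :
    Set ℝ :=
  {r | ∃ h ∈ 𝒢, r = |h x - ∫ y, h y ∂π|}

/-- The envelope `H(x) = sup_{h ∈ 𝒢} |h(x) - E_π[h]|` of the centered class (a real number wherever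
the deviations at `x` are bounded). -/
noncomputable def envelope {X : Type*} [MeasurableSpace X] (π : Measure X) (𝒢 : Set (X → ℝ))
    (x : X) : ℝ :=
  sSup (deviations π 𝒢 x)

/-- `E_π[exp(ξ²/c²)] ≤ 2`. The expectation is the outer one, through measurable majorants, because
an envelope of an uncountable class need not be measurable. -/
def SubGaussianWith {X : Type*} [MeasurableSpace X] (π : Measure X) (ξ : X → ℝ) (c : ℝ) : Prop :=
  ∃ g : X → ℝ≥0∞, Measurable g ∧ (∀ x, ENNReal.ofReal (Real.exp (ξ x ^ 2 / c ^ 2)) ≤ g x) ∧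
    ∫⁻ x, g x ∂π ≤ 2

/-- For measurable functions the outer expectation is the ordinary one. -/
theorem subGaussianWith_iff {X : Type*} [MeasurableSpace X] {π : Measure X} {ξ : X → ℝ}
    (hξ : Measurable ξ) (c : ℝ) :
    SubGaussianWith π ξ c ↔ ∫⁻ x, ENNReal.ofReal (Real.exp (ξ x ^ 2 / c ^ 2)) ∂π ≤ 2 := by
  constructor
  · rintro ⟨g, -, hg, h2⟩
    exact (lintegral_mono hg).trans h2
  · intro h
    exact ⟨_, by fun_prop, fun x => le_rfl, h⟩

/-- The sub-Gaussian norm `‖ξ‖_{ψ₂} = inf {c > 0 : E_π[exp(ξ²/c²)] ≤ 2}`, with value `∞` if there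
is no such `c`. -/
noncomputable def psiTwoNorm {X : Type*} [MeasurableSpace X] (π : Measure X) (ξ : X → ℝ) : ℝ≥0∞ :=
  ⨅ (c : ℝ) (_ : 0 < c ∧ SubGaussianWith π ξ c), ENNReal.ofReal c

/-! ### Augmentation -/

/-! Adding a constant to every leaf of a tree changes neither its splits nor the differences of its
values, which gives closure under augmentation. The VC bound is a counting argument. On `n` points,
a split takes at most `d * (n + 1)` forms and a leaf value at most `n + 1`. Recursion at the root
then bounds the traces of trees with `s` splits by `catalan s` times a polynomial in `n`
(`exists_finset_trace_mem_of_numSplits_eq`). A shattered set has `2 ^ n` traces, so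
`le_of_two_pow_le` bounds `n`. Subclasses inherit the bound by monotonicity. The envelope is at most
`M` pointwise, which controls its sub-Gaussian norm. -/

theorem subset_augmentation {X : Type*} (𝒢 : Set (X → ℝ)) : 𝒢 ⊆ augmentation 𝒢 :=
  fun g hg => ⟨g, hg, 0, by simp⟩

theorem augmentation_mono {X : Type*} {𝒢 𝒢' : Set (X → ℝ)} (h : 𝒢 ⊆ 𝒢') :
    augmentation 𝒢 ⊆ augmentation 𝒢' := by
  rintro _ ⟨g, hg, c, rfl⟩
  exact ⟨g, h hg, c, rfl⟩

namespace RegTree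

/-- The tree obtained by adding a constant to the value at every leaf. -/
def addConst {d : ℕ} (c : ℝ) : RegTree d → RegTree d
  | leaf a => leaf (a + c)
  | node i q l r => node i q (l.addConst c) (r.addConst c)

theorem numSplits_addConst {d : ℕ} (c : ℝ) (t : RegTree d) :
    (t.addConst c).numSplits = t.numSplits := by
  induction t with
  | leaf a => rfl
  | node i q l r hl hr => simp only [addConst, numSplits, hl, hr]

theorem eval_addConst {d : ℕ} (c : ℝ) (t : RegTree d) (x : Fin d → ℝ) :
    (t.addConst c).eval x = t.eval x + c := by
  induction t with
  | leaf a => rfl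
  | node i q l r hl hr =>
    simp only [addConst, eval, hl, hr]
    split_ifs <;> rfl

end RegTree

theorem add_const_mem_regressionTrees {d S : ℕ} {𝒳 : Set (Fin d → ℝ)} {h : 𝒳 → ℝ}
    (hh : h ∈ regressionTrees d S 𝒳) (c : ℝ) :
    (fun x => h x + c) ∈ regressionTrees d S 𝒳 := by
  obtain ⟨t, ht, rfl⟩ := hh
  exact ⟨t.addConst c, (t.numSplits_addConst c).le.trans ht,
    funext fun x => (t.eval_addConst c x).symm⟩

theorem augmentation_regressionTrees (d S : ℕ) (𝒳 : Set (Fin d → ℝ)) :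
    augmentation (regressionTrees d S 𝒳) = regressionTrees d S 𝒳 := by
  refine Set.Subset.antisymm ?_ (subset_augmentation _)
  rintro _ ⟨g, hg, c, rfl⟩
  exact add_const_mem_regressionTrees hg c

theorem augmentation_boundedRegressionTrees (d S : ℕ) (𝒳 : Set (Fin d → ℝ)) (M : ℝ) :
    augmentation (boundedRegressionTrees d S 𝒳 M) = boundedRegressionTrees d S 𝒳 M := by
  refine Set.Subset.antisymm ?_ (subset_augmentation _)
  rintro _ ⟨g, ⟨hg, hM⟩, c, rfl⟩
  exact ⟨add_const_mem_regressionTrees hg c, fun x y => by simpa using hM x y⟩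

/-! ### VC dimension -/

theorem ShatteredBy.mono {α : Type*} {F : Finset α} {𝒮 𝒮' : Set (Set α)} (h : 𝒮 ⊆ 𝒮')
    (hF : ShatteredBy F 𝒮) : ShatteredBy F 𝒮' := fun T hT =>
  let ⟨A, hA, hAT⟩ := hF T hT
  ⟨A, h hA, hAT⟩

theorem funVCDim_mono {X : Type*} {𝒢 𝒢' : Set (X → ℝ)} (h : 𝒢 ⊆ 𝒢') :
    funVCDim 𝒢 ≤ funVCDim 𝒢' := by
  refine iSup₂_le fun F hF => le_iSup₂_of_le F (hF.mono ?_) le_rfl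
  rintro _ ⟨g, hg, rfl⟩
  exact ⟨g, h hg, rfl⟩

theorem exists_funVCDim_eq_of_card_le {X : Type*} {𝒢 : Set (X → ℝ)} {B : ℝ}
    (hB : 0 ≤ B) (h : ∀ F : Finset (X × ℝ), ShatteredBy F (subgraphs 𝒢) → (F.card : ℝ) ≤ B) :
    ∃ v : ℕ, funVCDim 𝒢 = v ∧ (v : ℝ) ≤ B := by
  have hle : funVCDim 𝒢 ≤ (⌊B⌋₊ : ℕ) :=
    iSup₂_le fun F hF => by exact_mod_cast Nat.le_floor (h F hF)
  obtain ⟨v, hv⟩ := ENat.ne_top_iff_exists.1 (ne_top_of_le_ne_top (ENat.natCast_ne_top _) hle)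
  refine ⟨v, hv.symm, (Nat.le_floor_iff hB).1 ?_⟩
  rw [← hv] at hle
  exact_mod_cast hle

/-- A chain of subsets of a finite set is at most one longer than the set is large. -/
theorem card_le_of_isChain {α : Type*} {F : Finset α} {𝒜 : Finset (Finset α)}
    (hF : ∀ A ∈ 𝒜, A ⊆ F) (hc : IsChain (· ⊆ ·) (𝒜 : Set (Finset α))) :
    𝒜.card ≤ F.card + 1 := by
  rw [← Finset.card_range (F.card + 1)]
  -- Cardinality is injective on a chain, with values in `0, …, F.card`.
  refine Finset.card_le_card_of_injOn Finset.card
    (fun A hA => by simpa [Nat.lt_succ_iff] using Finset.card_le_card (hF A hA)) ?_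
  intro A hA B hB hAB
  rcases hc.total hA hB with h | h
  · exact Finset.eq_of_subset_of_card_le h hAB.ge
  · exact (Finset.eq_of_subset_of_card_le h hAB.le).symm

/-- A monotone real-indexed family of subsets of a finite set takes at most one more value than the
set has elements. -/
theorem exists_finset_traces_of_monotone {α : Type*} (F : Finset α)
    (A : ℝ → Finset α) (hF : ∀ q, A q ⊆ F) (hA : Monotone A) :
    ∃ 𝒜 : Finset (Finset α), 𝒜.card ≤ F.card + 1 ∧ ∀ q, A q ∈ 𝒜 := by
  classical
  refine ⟨F.powerset.filter fun B => ∃ q, A q = B, card_le_of_isChain (F := F) ?_ ?_, ?_⟩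
  · intro B hB
    exact Finset.mem_powerset.1 (Finset.mem_filter.1 hB).1
  · intro B hB B' hB' _
    obtain ⟨q, rfl⟩ := (Finset.mem_filter.1 (Finset.mem_coe.1 hB)).2
    obtain ⟨q', rfl⟩ := (Finset.mem_filter.1 (Finset.mem_coe.1 hB')).2
    exact (le_total q q').imp (fun h => hA h) (fun h => hA h)
  · intro q
    exact Finset.mem_filter.2 ⟨Finset.mem_powerset.2 (hF q), q, rfl⟩

namespace RegTree

/-- The points of `F` that lie in the subgraph of a tree. -/
noncomputable def trace {d : ℕ} (F : Finset ((Fin d → ℝ) × ℝ)) (t : RegTree d) :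
    Finset ((Fin d → ℝ) × ℝ) :=
  F.filter fun p => p.2 < t.eval p.1

/-- The threshold enters only through the points of `F` sent left, so finitely many root splits need
to be counted. -/
theorem trace_node {d : ℕ} (F : Finset ((Fin d → ℝ) × ℝ)) (i : Fin d) (q : ℝ)
    (l r : RegTree d) :
    (node i q l r).trace F =
      (l.trace F ∩ F.filter fun p => p.1 i ≤ q) ∪ (r.trace F \ F.filter fun p => p.1 i ≤ q) := by
  ext p
  simp only [trace, Finset.mem_union, Finset.mem_inter, Finset.mem_sdiff, Finset.mem_filter]
  simp only [eval]
  split_ifs <;> tauto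

/-- The number of subsets of a set of `n` points cut out by trees with exactly `s` splits. -/
theorem exists_finset_trace_mem_of_numSplits_eq {d : ℕ} (F : Finset ((Fin d → ℝ) × ℝ)) (s : ℕ) :
    ∃ 𝒜 : Finset (Finset ((Fin d → ℝ) × ℝ)),
      𝒜.card ≤ catalan s * ((d * (F.card + 1)) ^ s * (F.card + 1) ^ (s + 1)) ∧
      ∀ t : RegTree d, t.numSplits = s → t.trace F ∈ 𝒜 := by
  classical
  induction s using Nat.strong_induction_on with
  | _ s ih =>
  rcases s with _ | s
  · obtain ⟨𝒜, hcard, hmem⟩ := exists_finset_traces_of_monotone F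
      (fun c => F.filter fun p => p.2 < c) (fun c => Finset.filter_subset _ _)
      (fun a b hab => Finset.monotone_filter_right F fun p _ hp => lt_of_lt_of_le hp hab)
    refine ⟨𝒜, by simpa using hcard, fun t ht => ?_⟩
    cases t with
    | leaf c => exact hmem c
    | node i q l r => simp [numSplits] at ht
  · choose! 𝒜 hcard hmem using ih
    have hsplit (i : Fin d) := exists_finset_traces_of_monotone F
      (fun q => F.filter fun p => p.1 i ≤ q) (fun q => Finset.filter_subset _ _)
      (fun a b hab => Finset.monotone_filter_right F fun p _ hp => le_trans hp hab)
    choose 𝒟 hDcard hDmem using hsplit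
    let 𝒟' : Finset (Finset ((Fin d → ℝ) × ℝ)) := Finset.univ.biUnion 𝒟
    have hD' : 𝒟'.card ≤ d * (F.card + 1) := by
      simpa using Finset.card_biUnion_le_card_mul Finset.univ 𝒟 (F.card + 1) fun i _ => hDcard i
    -- The trace is determined by the root split and the traces of both subtrees on all of `F`.
    -- Summing over the sizes of the subtrees reproduces the Catalan recursion.
    refine ⟨(Finset.HasAntidiagonal.antidiagonal s).biUnion fun ab =>
      (𝒟' ×ˢ (𝒜 ab.1 ×ˢ 𝒜 ab.2)).image fun D => (D.2.1 ∩ D.1) ∪ (D.2.2 \ D.1), ?_, ?_⟩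
    · rw [catalan_succ', Finset.sum_mul]
      refine Finset.card_biUnion_le.trans (Finset.sum_le_sum fun ab hab => ?_)
      rw [Finset.HasAntidiagonal.mem_antidiagonal] at hab
      refine Finset.card_image_le.trans ?_
      rw [Finset.card_product, Finset.card_product]
      refine (Nat.mul_le_mul hD' (Nat.mul_le_mul (hcard ab.1 (by omega))
        (hcard ab.2 (by omega)))).trans_eq ?_
      subst hab
      ring
    · intro t ht
      cases t with
      | leaf c => simp [numSplits] at ht
      | node i q l r =>
        have hs : l.numSplits + r.numSplits = s := by simpa [numSplits] using ht
        rw [trace_node, Finset.mem_biUnion]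
        refine ⟨(l.numSplits, r.numSplits), Finset.HasAntidiagonal.mem_antidiagonal.2 hs, ?_⟩
        refine Finset.mem_image.2 ⟨(F.filter fun p => p.1 i ≤ q, l.trace F, r.trace F), ?_, rfl⟩
        refine Finset.mem_product.2 ⟨Finset.mem_biUnion.2 ⟨i, Finset.mem_univ i, hDmem i q⟩,
          Finset.mem_product.2 ⟨hmem _ (by omega) l rfl, hmem _ (by omega) r rfl⟩⟩

end RegTree

theorem catalan_le_four_pow (n : ℕ) : catalan n ≤ 4 ^ n := by
  rw [catalan_eq_centralBinom_div]
  refine (Nat.div_le_self _ _).trans ?_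
  rw [Nat.centralBinom_eq_two_mul_choose]
  refine (Nat.choose_le_two_pow _ _).trans_eq ?_
  rw [pow_mul]
  norm_num

/-- A shattered set of `n` points has at least `2 ^ n` traces, which bounds `n` implicitly. -/
theorem two_pow_card_le_of_shatteredBy {d S : ℕ} {𝒳 : Set (Fin d → ℝ)} {F : Finset (𝒳 × ℝ)}
    (hF : ShatteredBy F (subgraphs (regressionTrees d S 𝒳))) {D s : ℕ} (hD : 1 ≤ D) (hdD : d ≤ D)
    (hSs : S ≤ s) :
    2 ^ F.card ≤ (s + 1) * ((4 * D) ^ s * (F.card + 1) ^ (2 * s + 1)) := by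
  classical
  -- Moving the points to the ambient space makes the count independent of `𝒳`.
  let e : 𝒳 × ℝ ↪ (Fin d → ℝ) × ℝ :=
    ⟨fun p => (p.1, p.2), fun p p' h => by
      simp only [Prod.mk.injEq] at h
      exact Prod.ext (Subtype.ext h.1) h.2⟩
  have hcardF : (F.map e).card = F.card := Finset.card_map e
  choose 𝒜 hcard hmem using RegTree.exists_finset_trace_mem_of_numSplits_eq (F.map e)
  have hsub : F.powerset.image (Finset.map e) ⊆ (Finset.range (S + 1)).biUnion 𝒜 := by
    intro B hB
    obtain ⟨T, hT, rfl⟩ := Finset.mem_image.1 hB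
    obtain ⟨_, ⟨_, ⟨t, ht, rfl⟩, rfl⟩, hAT⟩ := hF T (Finset.mem_powerset.1 hT)
    have htrace : T.map e = t.trace (F.map e) := by
      have hT' : T = F.filter fun p => p.2 < t.eval p.1 := by
        ext p
        rw [← Finset.mem_coe, ← hAT]
        simp
      rw [hT', RegTree.trace, Finset.filter_map]
      rfl
    rw [htrace]
    exact Finset.mem_biUnion.2 ⟨t.numSplits, Finset.mem_range.2 (by omega), hmem _ t rfl⟩
  have h1 := Finset.card_le_card hsub
  rw [Finset.card_image_of_injective _ (Finset.map_injective e), Finset.card_powerset] at h1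
  refine h1.trans (Finset.card_biUnion_le.trans ?_)
  refine (Finset.sum_le_card_nsmul _ _ ((4 * D) ^ s * (F.card + 1) ^ (2 * s + 1))
    fun a ha => ?_).trans ?_
  · have ha : a ≤ s := by
      rw [Finset.mem_range] at ha
      omega
    refine (hcard a).trans ?_
    rw [hcardF]
    calc catalan a * ((d * (F.card + 1)) ^ a * (F.card + 1) ^ (a + 1))
        ≤ 4 ^ a * ((D * (F.card + 1)) ^ a * (F.card + 1) ^ (a + 1)) := by
          gcongr
          exact catalan_le_four_pow a
      _ = (4 * D) ^ a * (F.card + 1) ^ (2 * a + 1) := by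
          rw [mul_pow, mul_pow]
          ring
      _ ≤ (4 * D) ^ s * (F.card + 1) ^ (2 * s + 1) := by
          gcongr <;> omega
  · rw [Finset.card_range, smul_eq_mul]
    gcongr

/-- Solving the implicit bound of `two_pow_card_le_of_shatteredBy`. -/
theorem le_of_two_pow_le {n s D : ℕ} (hs : 2 ≤ s) (hD : 2 ≤ D)
    (h : 2 ^ n ≤ (s + 1) * ((4 * D) ^ s * (n + 1) ^ (2 * s + 1))) :
    (n : ℝ) ≤ 200 * (s : ℝ) ^ 2 * (Real.log s) ^ 2 * Real.log D := by
  have hpow : 2 ^ n ≤ (D * (n + 1)) ^ (4 * s) := by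
    refine h.trans ?_
    calc (s + 1) * ((4 * D) ^ s * (n + 1) ^ (2 * s + 1))
        ≤ 2 ^ s * ((4 * D) ^ s * (n + 1) ^ (4 * s)) := by
          gcongr
          · exact Nat.lt_two_pow_self
          · omega
          · omega
      _ = (2 ^ 3 * D) ^ s * (n + 1) ^ (4 * s) := by
          rw [← mul_assoc, ← mul_pow, ← mul_assoc]
          norm_num
      _ ≤ (D ^ 3 * D) ^ s * (n + 1) ^ (4 * s) := by gcongr
      _ = (D * (n + 1)) ^ (4 * s) := by
          rw [mul_pow D, pow_mul D, pow_succ D 3]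
  have hs' : (2 : ℝ) ≤ s := by exact_mod_cast hs
  have hD' : (2 : ℝ) ≤ D := by exact_mod_cast hD
  have hn : (0 : ℝ) ≤ n := Nat.cast_nonneg n
  have hlog : n * Real.log 2 ≤ 4 * s * (Real.log D + Real.log (n + 1)) := by
    have hpow' : (2 : ℝ) ^ n ≤ (D * (n + 1)) ^ (4 * s) := by exact_mod_cast hpow
    have := Real.log_le_log (by positivity) hpow'
    rw [Real.log_pow, Real.log_pow, Real.log_mul (by positivity) (by positivity)] at this
    exact_mod_cast this
  -- The tangent bound `log y ≤ y - 1` at `y = (n + 1) / (16 * s)`: after multiplication by `4 * s`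
  -- the linear term is `(n + 1) / 4`, which `n * log 2` absorbs, leaving the factor `0.44`.
  have hlog_n : Real.log (n + 1) ≤ (n + 1) / (16 * s) + 5 * Real.log s := by
    have h1 := Real.log_le_sub_one_of_pos (x := (n + 1) / (16 * s)) (by positivity)
    rw [Real.log_div (by positivity) (by positivity),
      Real.log_mul (by norm_num) (by positivity)] at h1
    have h2 : Real.log 16 = 4 * Real.log 2 := by
      rw [show (16 : ℝ) = 2 ^ 4 by norm_num, Real.log_pow]
      norm_num
    have h3 := Real.log_le_log (by norm_num) hs'
    linarith
  have hfrac : 4 * s * ((n + 1) / (16 * s)) = ((n : ℝ) + 1) / 4 := by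
    field_simp
    norm_num
  have h2 := Real.log_two_gt_d9
  have hℓ : 0.69 ≤ Real.log s := by linarith [Real.log_le_log (by norm_num) hs']
  have hL : 0.69 ≤ Real.log D := by linarith [Real.log_le_log (by norm_num) hD']
  set ℓ := Real.log s
  set L := Real.log D
  have hmain : 0.44 * n ≤ 4 * (s * L) + 1 / 4 + 20 * (s * ℓ) := by
    have := mul_le_mul_of_nonneg_left hlog_n (by positivity : (0 : ℝ) ≤ 4 * s)
    have h3 := mul_le_mul_of_nonneg_left (show 0.69 ≤ Real.log 2 by linarith) hn
    linarith
  -- `hmain` is already of order `s * (ℓ + L)`. The rest only weakens it to the product form, using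
  -- that `ℓ` and `L` are bounded below.
  have hℓL : 0.47 ≤ ℓ * L := by nlinarith
  have hℓℓ : 0.47 ≤ ℓ * ℓ := by nlinarith
  have hsl : 1 ≤ s * ℓ := by nlinarith
  have hss : (s : ℝ) ≤ (s : ℝ) ^ 2 := by nlinarith
  have b1 : 0.47 * (s * L) ≤ (s : ℝ) ^ 2 * ℓ ^ 2 * L := by
    calc 0.47 * (s * L) ≤ (ℓ * ℓ) * ((s : ℝ) ^ 2 * L) := by gcongr
      _ = _ := by ring
  have b2 : 0.47 * (s * ℓ) ≤ (s : ℝ) ^ 2 * ℓ ^ 2 * L := by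
    calc 0.47 * (s * ℓ) ≤ (ℓ * L) * ((s : ℝ) ^ 2 * ℓ) := by gcongr
      _ = _ := by ring
  linarith

theorem card_le_of_shatteredBy {d S : ℕ} {𝒳 : Set (Fin d → ℝ)} {F : Finset (𝒳 × ℝ)}
    (hF : ShatteredBy F (subgraphs (regressionTrees d S 𝒳))) {D s : ℕ} (hD : 2 ≤ D) (hdD : d ≤ D)
    (hs : 2 ≤ s) (hSs : S ≤ s) :
    (F.card : ℝ) ≤ 200 * (s : ℝ) ^ 2 * (Real.log s) ^ 2 * Real.log D :=
  le_of_two_pow_le hs hD (two_pow_card_le_of_shatteredBy hF (by omega) hdD hSs)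

theorem isVCSubgraph_regressionTrees (d S : ℕ) (𝒳 : Set (Fin d → ℝ)) :
    IsVCSubgraph (regressionTrees d S 𝒳) := by
  obtain ⟨v, hv, -⟩ := exists_funVCDim_eq_of_card_le (𝒢 := regressionTrees d S 𝒳)
    -- Enlarging both parameters by 2 covers `d` and `S` below 2.
    (by positivity) fun F hF => card_le_of_shatteredBy hF (D := d + 2) (s := S + 2)
    (by omega) (by omega) (by omega) (by omega)
  rw [IsVCSubgraph, hv]
  exact ENat.natCast_lt_top v

/-! ### The envelope -/

theorem abs_sub_integral_le {X : Type*} [MeasurableSpace X] {π : Measure X}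
    [IsProbabilityMeasure π] {h : X → ℝ} (hint : Integrable h π) {M : ℝ}
    (hM : ∀ x y, h x - h y ≤ M) (x : X) : |h x - ∫ y, h y ∂π| ≤ M := by
  have h1 : ∫ y, h y ∂π ≤ h x + M := by
    simpa using integral_mono hint (integrable_const (h x + M))
      fun y => by linarith [hM y x]
  have h2 : h x - M ≤ ∫ y, h y ∂π := by
    simpa using integral_mono (integrable_const (h x - M)) hint
      fun y => by linarith [hM x y]
  rw [abs_le]
  constructor <;> linarith

theorem psiTwoNorm_le_of_abs_le {X : Type*} [MeasurableSpace X] (π : Measure X)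
    [IsProbabilityMeasure π] {ξ : X → ℝ} {M : ℝ} (hM : 0 ≤ M) (h : ∀ x, |ξ x| ≤ M) :
    psiTwoNorm π ξ ≤ ENNReal.ofReal (2 * M) := by
  -- For `c ≥ 2 * M` the exponent is at most `1 / 4 < log 2`. Since `c` must be positive and `M` may
  -- vanish, `2 * M` is only approached from above.
  have key (c : ℝ) (hc : 0 < c) (hMc : 2 * M ≤ c) : psiTwoNorm π ξ ≤ ENNReal.ofReal c := by
    refine iInf₂_le_of_le c ⟨hc, fun _ => 2, measurable_const, fun x => ?_, by simp⟩ le_rfl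
    have hsq : ξ x ^ 2 / c ^ 2 ≤ Real.log 2 := by
      have h1 : ξ x ^ 2 ≤ M ^ 2 := sq_le_sq' (neg_le_of_abs_le (h x)) (le_of_abs_le (h x))
      rw [div_le_iff₀ (by positivity)]
      nlinarith [Real.log_two_gt_d9, sq_nonneg c]
    have h2 : Real.exp (ξ x ^ 2 / c ^ 2) ≤ 2 :=
      (Real.exp_le_exp.2 hsq).trans_eq (Real.exp_log two_pos)
    simpa using ENNReal.ofReal_le_ofReal h2
  refine ENNReal.le_of_forall_pos_le_add fun ε hε _ => ?_
  refine (key (2 * M + ε) (by positivity) (by simp)).trans ?_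
  rw [ENNReal.ofReal_add (by positivity) (by positivity), ENNReal.ofReal_coe_nnreal]

theorem mem_deviations_le {d S : ℕ} {𝒳 : Set (Fin d → ℝ)} {M : ℝ} {𝒢 : Set (𝒳 → ℝ)}
    (h𝒢 : 𝒢 ⊆ boundedRegressionTrees d S 𝒳 M) (π : Measure 𝒳) [IsProbabilityMeasure π]
    {x : 𝒳} {r : ℝ} (hr : r ∈ deviations π 𝒢 x) : r ≤ M := by
  obtain ⟨h, hh, rfl⟩ := hr
  exact abs_sub_integral_le (integrable_of_mem_regressionTrees (h𝒢 hh).1 π) (h𝒢 hh).2 x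

theorem abs_envelope_le {d S : ℕ} {𝒳 : Set (Fin d → ℝ)} {M : ℝ} (hM : 0 ≤ M) {𝒢 : Set (𝒳 → ℝ)}
    (h𝒢 : 𝒢 ⊆ boundedRegressionTrees d S 𝒳 M) (π : Measure 𝒳) [IsProbabilityMeasure π] (x : 𝒳) :
    |envelope π 𝒢 x| ≤ M := by
  rw [envelope, abs_of_nonneg]
  -- `0 ≤ M` covers an empty `𝒢`, where `sSup ∅ = 0`.
  · exact Real.sSup_le (fun r hr => mem_deviations_le h𝒢 π hr) hM
  · refine Real.sSup_nonneg ?_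
    rintro _ ⟨h, -, rfl⟩
    exact abs_nonneg _

theorem theorem5 :
    ∃ C C' : ℝ, 0 < C ∧ 0 < C' ∧ ∀ (d S : ℕ) (𝒳 : Set (Fin d → ℝ)),
      -- the class is its own augmentation and is VC-subgraph
      regressionTrees d S 𝒳 = augmentation (regressionTrees d S 𝒳) ∧
      IsVCSubgraph (regressionTrees d S 𝒳) ∧
      funVCDim (regressionTrees d S 𝒳) = funVCDim (augmentation (regressionTrees d S 𝒳)) ∧
      -- the bound on the VC dimension
      (2 ≤ S → 2 ≤ d → ∃ v : ℕ, funVCDim (regressionTrees d S 𝒳) = v ∧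
        (v : ℝ) ≤ C * (S : ℝ) ^ 2 * (Real.log S) ^ 2 * Real.log d) ∧
      -- trees of range at most `M`
      ∀ M : ℝ, 0 ≤ M →
        boundedRegressionTrees d S 𝒳 M = augmentation (boundedRegressionTrees d S 𝒳 M) ∧
        ∀ 𝒢 : Set (𝒳 → ℝ), 𝒢 ⊆ boundedRegressionTrees d S 𝒳 M →
          IsVCSubgraph (augmentation 𝒢) ∧
          funVCDim (augmentation 𝒢) ≤ funVCDim (regressionTrees d S 𝒳) ∧
          ∀ (π : Measure 𝒳) [IsProbabilityMeasure π],
            (∀ x, BddAbove (deviations π 𝒢 x)) ∧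
            psiTwoNorm π (envelope π 𝒢) ≤ ENNReal.ofReal (C' * M) := by
  refine ⟨200, 2, by norm_num, by norm_num, fun d S 𝒳 => ⟨(augmentation_regressionTrees d S 𝒳).symm,
    isVCSubgraph_regressionTrees d S 𝒳, by rw [augmentation_regressionTrees], fun hS hd => ?_,
    fun M hM => ⟨(augmentation_boundedRegressionTrees d S 𝒳 M).symm, fun 𝒢 h𝒢 => ?_⟩⟩⟩
  · exact exists_funVCDim_eq_of_card_le (by positivity)
      fun F hF => card_le_of_shatteredBy hF hd le_rfl hS le_rfl
  · have hle : funVCDim (augmentation 𝒢) ≤ funVCDim (regressionTrees d S 𝒳) := by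
      refine funVCDim_mono ((augmentation_mono h𝒢).trans ?_)
      rw [augmentation_boundedRegressionTrees]
      exact fun h hh => hh.1
    exact ⟨hle.trans_lt (isVCSubgraph_regressionTrees d S 𝒳), hle, fun π _ =>
      ⟨fun x => ⟨M, fun r hr => mem_deviations_le h𝒢 π hr⟩,
        psiTwoNorm_le_of_abs_le π hM (abs_envelope_le hM h𝒢 π)⟩⟩
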